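/- Let $n\in\mathbb{N}$, and let $\operatorname{Tam}_n$ be the Tamari lattice: the finite set of planar binary trees with $n$ inner vertices, partially ordered by the reflexive transitive closure of the following covering relations: a tree $T$ is covered by a tree $S$ if $S$ is obtained from $T$ by replacing, at some inner edge, a configuration $A\,(B\,C)$ (a vertex with left subtree $A$ whose right child has subtrees $B$ and $C$) by the configuration $(A\,B)\,C$ (a vertex with right subtree $C$ whose left child has subtrees $A$ and $B$). Let $I$ be the incidence matrix of $\operatorname{Tam}_n$, i.e. the integer matrix with rows and columns indexed by $\operatorname{Tam}_n$, with $I_{x,y}=1$ if $x\le y$ and $I_{x,y}=0$ otherwise; it is invertible over $\mathbb{Z}$. Let $C=-I\,(I^{-1})^{t}$ be the Coxeter matrix of $\operatorname{Tam}_n$. Then: 1. $C^{2n+2}=\operatorname{Id}$. 2. Every entry of $C$ is $0$, $1$ or $-1$. 3. For each column of $C$, all the nonzero entries of this column have the same sign. -/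

import Mathlib

/-- The covering relations of the Tamari order: `TamariCover S T` means that `T` arises from `S` by
replacing, at one inner edge, the configuration `a (b c)` (right child) by `(a b) c` (left child). -/
inductive TamariCover : BinaryTree Unit → BinaryTree Unit → Prop
  | rotate (a b c : BinaryTree Unit) :
      TamariCover (.node () a (.node () b c)) (.node () (.node () a b) c)
  | left {l l' : BinaryTree Unit} (r : BinaryTree Unit) :
      TamariCover l l' → TamariCover (.node () l r) (.node () l' r)
  | right (l : BinaryTree Unit) {r r' : BinaryTree Unit} :
      TamariCover r r' → TamariCover (.node () l r) (.node () l r')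

/-- The set of planar binary trees with `n` inner vertices. -/
def Tam (n : ℕ) : Type := {t : BinaryTree Unit // t.numNodes = n}

namespace Tam

instance (n : ℕ) : DecidableEq (Tam n) :=
  inferInstanceAs (DecidableEq {t : BinaryTree Unit // t.numNodes = n})

instance (n : ℕ) : Fintype (Tam n) :=
  Fintype.subtype (BinaryTree.treesOfNumNodesEq n)
    (fun _ => BinaryTree.mem_treesOfNumNodesEq)

end Tam

/-- The sum, over all inner vertices, of the sizes of their right subtrees; it is used only to show
that the Tamari order is antisymmetric. -/
def rightWeight : BinaryTree Unit → ℕ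
  | .nil => 0
  | .node _ l r => rightWeight l + rightWeight r + r.numNodes

theorem TamariCover.numNodes_eq {s t : BinaryTree Unit} (h : TamariCover s t) :
    s.numNodes = t.numNodes := by
  induction h with
  | rotate a b c => simp only [BinaryTree.numNodes]; omega
  | left r _ ih => simp only [BinaryTree.numNodes]; omega
  | right l _ ih => simp only [BinaryTree.numNodes]; omega

theorem TamariCover.rightWeight_lt {s t : BinaryTree Unit} (h : TamariCover s t) :
    rightWeight t < rightWeight s := by
  induction h with
  | rotate a b c => simp only [rightWeight, BinaryTree.numNodes]; omega
  | left r _ ih => simp only [rightWeight]; omega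
  | right l h ih =>
    have := h.numNodes_eq
    simp only [rightWeight]; omega

theorem eq_or_rightWeight_lt {s t : BinaryTree Unit}
    (h : Relation.ReflTransGen TamariCover s t) : s = t ∨ rightWeight t < rightWeight s := by
  induction h with
  | refl => exact Or.inl rfl
  | tail _ h ih =>
    right
    have := h.rightWeight_lt
    rcases ih with rfl | ih <;> omega

/-- The Tamari order: the reflexive transitive closure of the covering relations (a rotation keeps
the number of vertices, so all the trees in between have `n` vertices too). -/
instance Tam.instPartialOrder (n : ℕ) : PartialOrder (Tam n) where
  le S T := Relation.ReflTransGen TamariCover S.1 T.1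
  le_refl _ := Relation.ReflTransGen.refl
  le_trans _ _ _ h₁ h₂ := h₁.trans h₂
  le_antisymm S T h₁ h₂ := Subtype.ext (by
    rcases eq_or_rightWeight_lt h₁ with h | h
    · exact h
    · rcases eq_or_rightWeight_lt h₂ with h' | h'
      · exact h'.symm
      · omega)

open Classical in
/-- The incidence matrix of a finite poset: its entry at `(x, y)` is `1` if `x ≤ y` and `0`
otherwise. -/
noncomputable def incidenceMatrix (P : Type*) [PartialOrder P] : Matrix P P ℤ :=
  Matrix.of fun x y => if x ≤ y then 1 else 0

/-- The incidence matrix of a finite poset is invertible over `ℤ`, so that the inverse in the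
definition of the Coxeter matrix is the true one. -/
theorem isUnit_det_incidenceMatrix (P : Type*) [PartialOrder P] [Fintype P] [DecidableEq P] :
    IsUnit (incidenceMatrix P).det := by
  classical
  let _ : LocallyFiniteOrder P := Fintype.toLocallyFiniteOrder
  refine Matrix.isUnit_det_of_right_inverse
    (B := Matrix.of fun x y => IncidenceAlgebra.mu ℤ x y) ?_
  ext x y
  rw [Matrix.one_apply, ← IncidenceAlgebra.sum_Icc_mu_left x y, Matrix.mul_apply,
    ← Finset.sum_subset (Finset.subset_univ (Finset.Icc x y))]
  · refine Finset.sum_congr rfl fun z hz => ?_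
    simp [incidenceMatrix, (Finset.mem_Icc.1 hz).1]
  · intro z _ hz
    by_cases hxz : x ≤ z
    · have hzy : ¬ z ≤ y := fun h => hz (Finset.mem_Icc.2 ⟨hxz, h⟩)
      simp [IncidenceAlgebra.apply_eq_zero_of_not_le hzy]
    · simp [incidenceMatrix, hxz]

/-- The Coxeter matrix `C = -I (I⁻¹)ᵗ` of a finite poset with incidence matrix `I`. -/
noncomputable def coxeterMatrix (P : Type*) [PartialOrder P] [Fintype P] [DecidableEq P] :
    Matrix P P ℤ :=
  -(incidenceMatrix P * ((incidenceMatrix P)⁻¹).transpose)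

/-!
The proof works in the space of all integer-valued functions on planar binary trees, on which the
Coxeter matrices act by one operator `cox`. Two bilinear operations are used: the product `f ⋆ g`,
dual to cutting a tree between two consecutive vertices of the in-order numbering (the product of the
Loday–Ronco algebra), and the grafting `f ⋎ g` on a common root. They satisfy
`(x ⋎ y) ⋆ (z ⋎ w) = x ⋎ (y ⋆ (z ⋎ w)) + ((x ⋎ y) ⋆ z) ⋎ w` (`vee_conv_vee`).

Write `U t` and `D t` for the indicator functions of the trees above and below `t`. Because cutting
is monotone, `U (node l r) = (U l ⋎ 1) ⋆ U r` and `D (node l r) = D l ⋆ (1 ⋎ D r)`, where `1` is the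
indicator function of the empty tree. The Coxeter matrix sends `U t` to `- D t`, and the functions
`U t` span, so `cox` is determined by `cox 1 = -1` and
`cox ((f ⋎ 1) ⋆ g) = - cox f ⋆ (1 ⋎ cox g)`. From this, an induction on `b` gives the key identity
`cox ((a ⋎ cox b) ⋆ c) = (-1) ^ |b| • cox a ⋆ (b ⋎ cox c)` (`cox_conv`).

With `m(a, b, c) = (a ⋎ cox b) ⋆ c` the identity reads
`cox (m(a, b, c)) ⋆ s = ± cox a ⋆ m(b, c, s)`: up to sign, `cox` acts on functions built with `m` as
the change of root of a planar ternary tree to its first leaf. A ternary tree with `n` inner vertices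
has `2 n + 2` leaves, the root counted as one of them, whence the period; following the signs shows
that they cancel after one turn (`cox_pow_conv_upInd`, `cox_pow_eq`).

For the entries, consider the smallest family that contains `1` and is closed under sign and `m`. By
the identity it is stable under `cox`. It contains the indicator function of each tree, since
grafting is `m(a, cox⁻¹ b, 1)` and `cox` is periodic. All its members are `0/1`-valued up to a global
sign, because a product of homogeneous functions involves a single cut of each tree. The columns of
the Coxeter matrix are the images of the indicator functions of trees under `cox`.
-/

namespace TamariCoxeter

/-- The integer-valued functions on all planar binary trees. -/
abbrev TreeFun : Type := BinaryTree Unit → ℤ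

/-! ### Cutting trees and the Tamari order -/

/-- The Tamari order on all planar binary trees; trees of different sizes are incomparable. -/
def TamariLE (s t : BinaryTree Unit) : Prop := Relation.ReflTransGen TamariCover s t

/-- The restriction of a tree to its first `p` vertices in the symmetric (in-order) numbering. -/
def take : ℕ → BinaryTree Unit → BinaryTree Unit
  | _, .nil => .nil
  | p, .node _ l r =>
    if p ≤ l.numNodes then take p l else .node () l (take (p - l.numNodes - 1) r)

/-- The restriction of a tree to all but its first `p` vertices in the symmetric (in-order)
numbering. -/
def drop : ℕ → BinaryTree Unit → BinaryTree Unit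
  | _, .nil => .nil
  | p, .node _ l r =>
    if p ≤ l.numNodes then .node () (drop p l) r else drop (p - l.numNodes - 1) r

theorem TamariLE.refl (t : BinaryTree Unit) : TamariLE t t := Relation.ReflTransGen.refl

theorem TamariLE.trans {s t u : BinaryTree Unit} (h : TamariLE s t) (h' : TamariLE t u) :
    TamariLE s u := Relation.ReflTransGen.trans h h'

theorem TamariLE.of_cover {s t : BinaryTree Unit} (h : TamariCover s t) : TamariLE s t :=
  Relation.ReflTransGen.single h

theorem TamariLE.numNodes_eq {s t : BinaryTree Unit} (h : TamariLE s t) :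
    s.numNodes = t.numNodes := by
  induction h with
  | refl => rfl
  | tail _ h ih => exact ih.trans h.numNodes_eq

theorem TamariLE.node {l l' r r' : BinaryTree Unit} (hl : TamariLE l l') (hr : TamariLE r r') :
    TamariLE (.node () l r) (.node () l' r') :=
  TamariLE.trans (Relation.ReflTransGen.lift (fun x => BinaryTree.node () x r)
    (fun _ _ h => TamariCover.left r h) _ _ hl)
    (Relation.ReflTransGen.lift (fun x => BinaryTree.node () l' x)
      (fun _ _ h => TamariCover.right l' h) _ _ hr)

@[simp] theorem take_zero (t : BinaryTree Unit) : take 0 t = .nil := by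
  induction t with
  | nil => rfl
  | node _ l r ihl _ => simp [take, ihl]

@[simp] theorem drop_zero (t : BinaryTree Unit) : drop 0 t = t := by
  induction t with
  | nil => rfl
  | node _ l r ihl _ => simp [drop, ihl]

theorem numNodes_take {p : ℕ} {t : BinaryTree Unit} (h : p ≤ t.numNodes) :
    (take p t).numNodes = p := by
  induction t generalizing p with
  | nil => simp_all [take, BinaryTree.numNodes]
  | node _ l r ihl ihr =>
    simp only [take, BinaryTree.numNodes] at h ⊢
    split_ifs with hp
    · exact ihl hp
    · simp only [BinaryTree.numNodes, ihr (p := p - l.numNodes - 1) (by omega)]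
      omega

theorem numNodes_drop {p : ℕ} {t : BinaryTree Unit} (h : p ≤ t.numNodes) :
    (drop p t).numNodes = t.numNodes - p := by
  induction t generalizing p with
  | nil => simp_all [drop, BinaryTree.numNodes]
  | node _ l r ihl ihr =>
    simp only [drop, BinaryTree.numNodes] at h ⊢
    split_ifs with hp
    · simp only [BinaryTree.numNodes, ihl hp]
      omega
    · rw [ihr (by omega)]
      omega

theorem take_of_le {p : ℕ} {t : BinaryTree Unit} (h : t.numNodes ≤ p) : take p t = t := by
  induction t generalizing p with
  | nil => rfl
  | node _ l r ihl ihr =>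
    simp only [BinaryTree.numNodes] at h
    rw [take, if_neg (by omega), ihr (by omega)]

theorem take_cover {s t : BinaryTree Unit} (h : TamariCover s t) (p : ℕ) :
    TamariLE (take p s) (take p t) := by
  induction h generalizing p with
  | rotate a b c =>
    simp only [take, BinaryTree.numNodes]
    have e : p - (a.numNodes + b.numNodes + 1) - 1 = p - a.numNodes - 1 - b.numNodes - 1 := by
      omega
    rw [e]
    split_ifs <;> first | omega | exact .refl _ | exact .of_cover (.rotate _ _ _)
  | left r h ih =>
    simp only [take, h.numNodes_eq]
    split_ifs
    · exact ih p
    · exact .node (.of_cover h) (.refl _)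
  | right l h ih =>
    simp only [take]
    split_ifs
    · exact .refl _
    · exact .node (.refl _) (ih _)

theorem drop_cover {s t : BinaryTree Unit} (h : TamariCover s t) (p : ℕ) :
    TamariLE (drop p s) (drop p t) := by
  induction h generalizing p with
  | rotate a b c =>
    simp only [drop, BinaryTree.numNodes]
    have e : p - (a.numNodes + b.numNodes + 1) - 1 = p - a.numNodes - 1 - b.numNodes - 1 := by
      omega
    rw [e]
    split_ifs <;> first | omega | exact .refl _ | exact .of_cover (.rotate _ _ _)
  | left r h ih =>
    simp only [drop, h.numNodes_eq]
    split_ifs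
    · exact .node (ih p) (.refl _)
    · exact .refl _
  | right l h ih =>
    simp only [drop]
    split_ifs
    · exact .node (.refl _) (.of_cover h)
    · exact ih _

theorem TamariLE.take {s t : BinaryTree Unit} (h : TamariLE s t) (p : ℕ) :
    TamariLE (take p s) (take p t) := by
  induction h with
  | refl => exact .refl _
  | tail _ h ih => exact ih.trans (take_cover h p)

theorem TamariLE.drop {s t : BinaryTree Unit} (h : TamariLE s t) (p : ℕ) :
    TamariLE (drop p s) (drop p t) := by
  induction h with
  | refl => exact .refl _
  | tail _ h ih => exact ih.trans (drop_cover h p)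

theorem node_nil_le {l t : BinaryTree Unit} (h : TamariLE (.node () l .nil) t) :
    ∃ u, t = .node () u .nil ∧ TamariLE l u := by
  induction h with
  | refl => exact ⟨l, rfl, .refl _⟩
  | tail _ h ih =>
    obtain ⟨u, rfl, hu⟩ := ih
    cases h with
    | left _ h => exact ⟨_, rfl, hu.trans (.of_cover h)⟩
    | right _ h => cases h

theorem le_nil_node {r t : BinaryTree Unit} (h : TamariLE t (.node () .nil r)) :
    ∃ u, t = .node () .nil u ∧ TamariLE u r := by
  induction h using Relation.ReflTransGen.head_induction_on with
  | refl => exact ⟨r, rfl, .refl _⟩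
  | head h _ ih =>
    obtain ⟨u, rfl, hu⟩ := ih
    cases h with
    | left _ h => cases h
    | right _ h => exact ⟨_, rfl, .trans (.of_cover h) hu⟩

/-- If a tree is cut just after a vertex `v` which becomes the root of the initial part, then hanging
the remainder at `v` on the right gives a smaller tree. -/
theorem node_drop_le {p : ℕ} {t u : BinaryTree Unit} (hp : p ≤ t.numNodes)
    (h : take p t = .node () u .nil) : TamariLE (.node () u (drop p t)) t := by
  induction t generalizing p with
  | nil => cases h
  | node x l r ihl ihr =>
    simp only [take, drop, BinaryTree.numNodes] at h hp ⊢
    split_ifs at h ⊢ with hl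
    · exact .trans (.of_cover (.rotate _ _ _)) (.node (ihl hl h) (.refl _))
    · obtain ⟨-, rfl, h2⟩ := BinaryTree.node.inj h
      have := numNodes_take (p := p - l.numNodes - 1) (t := r) (by omega)
      rw [h2] at this
      simp only [BinaryTree.numNodes] at this
      rw [← this, drop_zero]
      exact .refl _

/-- If a tree is cut just before a vertex `v` which becomes the root of the remaining part, then
hanging the initial part at `v` on the left gives a larger tree. -/
theorem le_node_take {p : ℕ} {t u : BinaryTree Unit} (hp : p ≤ t.numNodes)
    (h : drop p t = .node () .nil u) : TamariLE t (.node () (take p t) u) := by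
  induction t generalizing p with
  | nil => cases h
  | node x l r ihl ihr =>
    simp only [take, drop, BinaryTree.numNodes] at h hp ⊢
    split_ifs at h ⊢ with hl
    · obtain ⟨-, h2, rfl⟩ := BinaryTree.node.inj h
      have := numNodes_drop hl
      rw [h2] at this
      simp only [BinaryTree.numNodes] at this
      rw [take_of_le (by omega)]
      exact .refl _
    · exact .trans (.node (.refl _) (ihr (by omega) h)) (.of_cover (.rotate _ _ _))

/-! ### The product and the grafting of functions on trees -/

/-- The value at `t` of the product of `f` and `g`: the sum of `f t₁ * g t₂` over all the ways to
cut `t` into the restriction `t₁` to an initial segment of its vertices and the restriction `t₂` to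
the remaining ones. -/
def convAt : BinaryTree Unit → TreeFun → TreeFun → ℤ
  | .nil, f, g => f .nil * g .nil
  | .node _ l r, f, g =>
    convAt l f (fun l' => g (.node () l' r)) + convAt r (fun r' => f (.node () l r')) g

theorem convAt_add_left (t : BinaryTree Unit) (f f' g : TreeFun) :
    convAt t (f + f') g = convAt t f g + convAt t f' g := by
  induction t generalizing f f' g with
  | nil => simp [convAt, add_mul]
  | node _ l r ihl ihr =>
    have := ihr (fun r' => f (.node () l r')) (fun r' => f' (.node () l r')) g
    simp only [convAt, ihl]
    simp only [Pi.add_apply]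
    simp only [Pi.add_def] at this
    rw [this]; ring

theorem convAt_smul_left (t : BinaryTree Unit) (c : ℤ) (f g : TreeFun) :
    convAt t (c • f) g = c * convAt t f g := by
  induction t generalizing f g with
  | nil => simp [convAt, mul_assoc]
  | node _ l r ihl ihr =>
    have := ihr (fun r' => f (.node () l r')) g
    simp only [convAt, ihl]
    simp only [Pi.smul_apply]
    simp only [Pi.smul_def] at this
    rw [this]; ring

theorem convAt_add_right (t : BinaryTree Unit) (f g g' : TreeFun) :
    convAt t f (g + g') = convAt t f g + convAt t f g' := by
  induction t generalizing f g g' with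
  | nil => simp [convAt, mul_add]
  | node _ l r ihl ihr =>
    have := ihl f (fun l' => g (.node () l' r)) (fun l' => g' (.node () l' r))
    simp only [convAt, ihr]
    simp only [Pi.add_apply]
    simp only [Pi.add_def] at this
    rw [this]; ring

theorem convAt_smul_right (t : BinaryTree Unit) (c : ℤ) (f g : TreeFun) :
    convAt t f (c • g) = c * convAt t f g := by
  induction t generalizing f g with
  | nil => simp [convAt, mul_left_comm]
  | node _ l r ihl ihr =>
    have := ihl f (fun l' => g (.node () l' r))
    simp only [convAt, ihr]
    simp only [Pi.smul_apply]
    simp only [Pi.smul_def] at this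
    rw [this]; ring

/-- The product of functions on trees, dual to cutting a tree in two; on indicator functions of
trees it is the product of the Loday–Ronco algebra. -/
def conv : TreeFun →ₗ[ℤ] TreeFun →ₗ[ℤ] TreeFun :=
  LinearMap.mk₂ ℤ (fun f g t => convAt t f g)
    (fun f f' g => funext fun t => convAt_add_left t f f' g)
    (fun c f g => funext fun t => convAt_smul_left t c f g)
    (fun f g g' => funext fun t => convAt_add_right t f g g')
    (fun c f g => funext fun t => convAt_smul_right t c f g)

/-- The bilinear extension of grafting two trees on a common root, from indicator functions of trees
to all functions on trees. -/
def vee : TreeFun →ₗ[ℤ] TreeFun →ₗ[ℤ] TreeFun :=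
  LinearMap.mk₂ ℤ (fun f g t => match t with
      | .nil => 0
      | .node _ l r => f l * g r)
    (fun f f' g => by ext t; cases t <;> simp [add_mul])
    (fun c f g => by ext t; cases t <;> simp [mul_assoc])
    (fun f g g' => by ext t; cases t <;> simp [mul_add])
    (fun c f g => by ext t; cases t <;> simp [mul_left_comm])

/-- The indicator function of a single tree. -/
def delta (s : BinaryTree Unit) : TreeFun := fun t => if t = s then 1 else 0

/-- The indicator function of the empty tree, the unit of the product. -/
def one : TreeFun := delta .nil

local notation:70 f:70 " ⋆ " g:71 => conv f g
local notation:75 f:75 " ⋎ " g:76 => vee f g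

theorem conv_apply_nil (f g : TreeFun) : (f ⋆ g) .nil = f .nil * g .nil := rfl

theorem conv_apply_node (f g : TreeFun) (l r : BinaryTree Unit) :
    (f ⋆ g) (.node () l r) = (f ⋆ fun l' => g (.node () l' r)) l +
      ((fun r' => f (.node () l r')) ⋆ g) r := rfl

theorem vee_apply_nil (f g : TreeFun) : (f ⋎ g) .nil = 0 := rfl

theorem vee_apply_node (f g : TreeFun) (l r : BinaryTree Unit) :
    (f ⋎ g) (.node () l r) = f l * g r := rfl

theorem one_conv (f : TreeFun) : one ⋆ f = f := by
  ext t
  induction t generalizing f with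
  | nil => simp [conv_apply_nil, one, delta]
  | node _ l r ihl ihr =>
    have e : (fun r' => one (.node () l r')) = 0 := by ext; simp [one, delta]
    have := conv_apply_node one f l r
    simp only [ihl, e, map_zero, LinearMap.zero_apply, Pi.zero_apply, add_zero] at this ⊢
    exact this

theorem conv_one (f : TreeFun) : f ⋆ one = f := by
  ext t
  induction t generalizing f with
  | nil => simp [conv_apply_nil, one, delta]
  | node _ l r ihl ihr =>
    have e : (fun l' => one (.node () l' r)) = 0 := by ext; simp [one, delta]
    have := conv_apply_node f one l r
    simp only [ihr, e, map_zero, Pi.zero_apply, zero_add] at this ⊢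
    exact this

/-- Cutting one tree and cutting another one commute. -/
theorem conv_conv_swap (f h : TreeFun) (G : BinaryTree Unit → TreeFun) (l r : BinaryTree Unit) :
    (f ⋆ fun l' => (G l' ⋆ h) r) l = ((fun r' => (f ⋆ fun l' => G l' r') l) ⋆ h) r := by
  induction l generalizing f G with
  | nil =>
    have e : (fun r' => (f ⋆ fun l' => G l' r') .nil) = f .nil • G .nil := by
      ext r'; simp [conv_apply_nil]
    simp only [e, map_smul, LinearMap.smul_apply, Pi.smul_apply, smul_eq_mul]
    rfl
  | node _ a b iha ihb =>
    have e : (fun r' => (f ⋆ fun l' => G l' r') (.node () a b)) =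
        (fun r' => (f ⋆ fun l' => G (.node () l' b) r') a) +
          (fun r' => ((fun b' => f (.node () a b')) ⋆ fun l' => G l' r') b) := by
      ext r'; rfl
    have h1 := iha f (fun l' => G (.node () l' b))
    have h2 := ihb (fun b' => f (.node () a b')) G
    simp only [e, map_add, LinearMap.add_apply, Pi.add_apply] at h1 h2 ⊢
    rw [← h1, ← h2]
    rfl

theorem conv_assoc (f g h : TreeFun) : f ⋆ g ⋆ h = f ⋆ (g ⋆ h) := by
  ext t
  induction t generalizing f g h with
  | nil => simp [conv_apply_nil, mul_assoc]
  | node _ l r ihl ihr =>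
    have h1 := conv_apply_node (f ⋆ g) h l r
    have h2 := conv_apply_node f (g ⋆ h) l r
    have e1 : (fun r' => (f ⋆ g) (.node () l r')) =
        (fun r' => (f ⋆ fun l' => g (.node () l' r')) l) +
          ((fun r' => f (.node () l r')) ⋆ g) := by
      ext r'; rfl
    have e2 : (fun l' => (g ⋆ h) (.node () l' r)) =
        (g ⋆ fun l' => h (.node () l' r)) +
          (fun l' => ((fun r' => g (.node () l' r')) ⋆ h) r) := by
      ext l'; rfl
    have e3 := conv_conv_swap f h (fun l' r' => g (.node () l' r')) l r
    simp only [e1, e2, map_add, LinearMap.add_apply, Pi.add_apply, ihl, ihr] at h1 h2 e3 ⊢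
    rw [h1, h2, e3]
    ring

/-- The recursion for the product of two grafted trees: a tree in it is rooted either at the root of
the first factor or at the root of the second one. -/
theorem vee_conv_vee (x y z w : TreeFun) :
    x ⋎ y ⋆ (z ⋎ w) = x ⋎ (y ⋆ (z ⋎ w)) + (x ⋎ y ⋆ z) ⋎ w := by
  ext t
  cases t with
  | nil => simp [conv_apply_nil, vee_apply_nil]
  | node _ l r =>
    have h := conv_apply_node (x ⋎ y) (z ⋎ w) l r
    have e1 : (fun l' => (z ⋎ w) (.node () l' r)) = w r • z := by
      ext l'; simp [vee_apply_node, mul_comm]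
    have e2 : (fun r' => (x ⋎ y) (.node () l r')) = x l • y := by
      ext r'; simp [vee_apply_node]
    simp only [e1, e2, map_smul, LinearMap.smul_apply, Pi.smul_apply, smul_eq_mul] at h
    simp only [Pi.add_apply]
    rw [h, mul_comm, add_comm]
    rfl

/-! ### Homogeneous functions -/

/-- The functions supported on the trees with `n` inner vertices. -/
def homog (n : ℕ) : Submodule ℤ TreeFun where
  carrier := {f | ∀ t, t.numNodes ≠ n → f t = 0}
  add_mem' hf hg t ht := by simp [hf t ht, hg t ht]
  zero_mem' _ _ := rfl
  smul_mem' c f hf t ht := by simp [hf t ht]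

theorem delta_mem (s : BinaryTree Unit) : delta s ∈ homog s.numNodes := by
  intro t ht
  rw [delta, if_neg]
  rintro rfl
  exact ht rfl

theorem one_mem : one ∈ homog 0 := delta_mem .nil

theorem vee_mem {p q : ℕ} {f g : TreeFun} (hf : f ∈ homog p) (hg : g ∈ homog q) :
    f ⋎ g ∈ homog (p + q + 1) := by
  intro t ht
  cases t with
  | nil => rfl
  | node _ l r =>
    rw [vee_apply_node]
    by_cases hl : l.numNodes = p
    · rw [hg r, mul_zero]
      simp only [BinaryTree.numNodes] at ht
      omega
    · rw [hf l hl, zero_mul]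

theorem conv_apply_of_mem {p : ℕ} {f : TreeFun} (hf : f ∈ homog p) (g : TreeFun)
    (t : BinaryTree Unit) :
    (f ⋆ g) t = if p ≤ t.numNodes then f (take p t) * g (drop p t) else 0 := by
  induction t generalizing p f g with
  | nil =>
    split_ifs with h
    · rfl
    · rw [conv_apply_nil, hf .nil (by simp [BinaryTree.numNodes] at h ⊢; omega), zero_mul]
  | node _ l r ihl ihr =>
    have h := conv_apply_node f g l r
    have hn : (BinaryTree.node () l r).numNodes = l.numNodes + r.numNodes + 1 := rfl
    rw [h, ihl hf, take, drop, hn]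
    by_cases hp : p ≤ l.numNodes
    · have e : (fun r' => f (.node () l r')) = 0 := by
        ext r'
        exact hf _ (by simp only [BinaryTree.numNodes]; omega)
      rw [e, if_pos hp, if_pos hp, if_pos hp, if_pos (by omega)]
      simp
    · have e : (fun r' => f (.node () l r')) ∈ homog (p - l.numNodes - 1) := by
        intro r' hr'
        exact hf _ (by simp only [BinaryTree.numNodes]; omega)
      have h' := ihr e g
      rw [if_neg hp, if_neg hp, if_neg hp, h', zero_add]
      refine if_congr (by omega) rfl rfl

theorem conv_mem {p q : ℕ} {f g : TreeFun} (hf : f ∈ homog p) (hg : g ∈ homog q) :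
    f ⋆ g ∈ homog (p + q) := by
  intro t ht
  rw [conv_apply_of_mem hf]
  split_ifs with h
  · rw [hg (drop p t), mul_zero]
    rw [numNodes_drop h]
    omega
  · rfl

open Classical in
/-- The indicator function of the set of all trees above `s` in the Tamari order. -/
noncomputable def upInd (s : BinaryTree Unit) : TreeFun := fun t => if TamariLE s t then 1 else 0

open Classical in
/-- The indicator function of the set of all trees below `s` in the Tamari order. -/
noncomputable def downInd (s : BinaryTree Unit) : TreeFun := fun t => if TamariLE t s then 1 else 0

theorem upInd_mem (s : BinaryTree Unit) : upInd s ∈ homog s.numNodes := fun _ ht =>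
  if_neg fun h => ht h.numNodes_eq.symm

theorem downInd_mem (s : BinaryTree Unit) : downInd s ∈ homog s.numNodes := fun _ ht =>
  if_neg fun h => ht h.numNodes_eq

theorem eq_nil_of_numNodes {t : BinaryTree Unit} (h : t.numNodes = 0) : t = .nil := by
  cases t with
  | nil => rfl
  | node _ l r => simp [BinaryTree.numNodes] at h

theorem upInd_nil : upInd .nil = one := by
  classical
  ext t
  rw [upInd, one, delta]
  exact if_congr ⟨fun h => eq_nil_of_numNodes h.numNodes_eq.symm, fun h => h ▸ .refl _⟩ rfl rfl

theorem downInd_nil : downInd .nil = one := by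
  classical
  ext t
  rw [downInd, one, delta]
  exact if_congr ⟨fun h => eq_nil_of_numNodes h.numNodes_eq, fun h => h ▸ .refl _⟩ rfl rfl

theorem node_le_iff {l r t : BinaryTree Unit} :
    TamariLE (.node () l r) t ↔ l.numNodes + 1 ≤ t.numNodes ∧
      (∃ u, take (l.numNodes + 1) t = .node () u .nil ∧ TamariLE l u) ∧
      TamariLE r (drop (l.numNodes + 1) t) := by
  constructor
  · intro h
    have h1 := h.take (l.numNodes + 1)
    have h2 := h.drop (l.numNodes + 1)
    have h3 := h.numNodes_eq
    simp only [take, drop, BinaryTree.numNodes, if_neg (Nat.not_succ_le_self l.numNodes)]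
      at h1 h2 h3
    simp only [Nat.add_sub_cancel_left, Nat.sub_self, take_zero, drop_zero] at h1 h2
    exact ⟨by omega, node_nil_le h1, h2⟩
  · rintro ⟨hp, ⟨u, h, hu⟩, hr⟩
    exact .trans (.node hu hr) (node_drop_le hp h)

theorem le_node_iff {l r t : BinaryTree Unit} :
    TamariLE t (.node () l r) ↔ l.numNodes ≤ t.numNodes ∧ TamariLE (take l.numNodes t) l ∧
      ∃ u, drop l.numNodes t = .node () .nil u ∧ TamariLE u r := by
  constructor
  · intro h
    have h1 := h.take l.numNodes
    have h2 := h.drop l.numNodes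
    have h3 := h.numNodes_eq
    simp only [take, drop, BinaryTree.numNodes, if_pos le_rfl, take_of_le le_rfl] at h1 h2 h3
    have e := eq_nil_of_numNodes ((numNodes_drop le_rfl).trans (Nat.sub_self l.numNodes))
    rw [e] at h2
    exact ⟨by omega, h1, le_nil_node h2⟩
  · rintro ⟨hp, hl, ⟨u, h, hu⟩⟩
    exact .trans (le_node_take hp h) (.node hl hu)

/-- The trees above a grafted tree factor: the restriction to the vertices up to the root lies above
the left part, and the restriction to the other vertices above the right part. -/
theorem upInd_node (l r : BinaryTree Unit) :
    upInd (.node () l r) = upInd l ⋎ one ⋆ upInd r := by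
  classical
  ext t
  rw [conv_apply_of_mem (vee_mem (upInd_mem l) one_mem), upInd, if_congr node_le_iff rfl rfl]
  simp only [add_zero]
  by_cases hp : l.numNodes + 1 ≤ t.numNodes
  · simp only [hp, true_and, if_true]
    cases h : take (l.numNodes + 1) t with
    | nil => simp [vee_apply_nil]
    | node _ u v =>
      rw [vee_apply_node]
      by_cases hv : v = .nil
      · subst hv
        simp [upInd, one, delta, ite_and]
        split_ifs <;> rfl
      · simp [upInd, one, delta, hv]
  · simp [hp]

theorem downInd_node (l r : BinaryTree Unit) :
    downInd (.node () l r) = downInd l ⋆ (one ⋎ downInd r) := by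
  classical
  ext t
  rw [conv_apply_of_mem (downInd_mem l), downInd, if_congr le_node_iff rfl rfl]
  by_cases hp : l.numNodes ≤ t.numNodes
  · simp only [hp, true_and, if_true]
    cases h : drop l.numNodes t with
    | nil => simp [vee_apply_nil]
    | node _ u v =>
      rw [vee_apply_node]
      by_cases hv : u = .nil
      · subst hv
        simp [downInd, one, delta, ite_and]
        split_ifs <;> rfl
      · simp [downInd, one, delta, hv]
  · simp [hp]

theorem exists_numNodes_eq (n : ℕ) : ∃ t : BinaryTree Unit, t.numNodes = n := by
  induction n with
  | zero => exact ⟨.nil, rfl⟩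
  | succ n ih =>
    obtain ⟨t, rfl⟩ := ih
    exact ⟨.node () .nil t, by simp [BinaryTree.numNodes]⟩

/-- The indicator functions of principal up-sets span the homogeneous functions, because the
incidence matrix is invertible. -/
theorem homog_induction {n : ℕ} {P : TreeFun → Prop} (hadd : ∀ f g, P f → P g → P (f + g))
    (hsmul : ∀ (c : ℤ) f, P f → P (c • f)) (hup : ∀ s, s.numNodes = n → P (upInd s))
    {f : TreeFun} (hf : f ∈ homog n) : P f := by
  classical
  let I := (incidenceMatrix (Tam n)).transpose
  have hI : IsUnit I.det := by
    rw [Matrix.det_transpose]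
    exact isUnit_det_incidenceMatrix _
  let v : Tam n → ℤ := I⁻¹.mulVec fun s => f s.1
  have key : f = ∑ s : Tam n, v s • upInd s.1 := by
    ext t
    rw [Finset.sum_apply]
    by_cases ht : t.numNodes = n
    · have h : I.mulVec v = fun s => f s.1 := by
        rw [Matrix.mulVec_mulVec, Matrix.mul_nonsing_inv _ hI, Matrix.one_mulVec]
      have h' := congrFun h ⟨t, ht⟩
      rw [← h']
      refine Finset.sum_congr rfl fun s _ => ?_
      rw [Pi.smul_apply, smul_eq_mul, mul_comm]
      rfl
    · rw [hf t ht]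
      refine (Finset.sum_eq_zero fun s _ => ?_).symm
      rw [Pi.smul_apply, upInd_mem s.1 t (by rw [s.2]; exact ht), smul_zero]
  obtain ⟨s, hs⟩ := exists_numNodes_eq n
  have hzero : P 0 := by simpa using hsmul 0 _ (hup s hs)
  rw [key]
  exact Finset.sum_induction _ P hadd hzero fun s _ => hsmul _ _ (hup s.1 s.2)

/-! ### The Coxeter transformation -/

/-- The Coxeter matrices of all the Tamari lattices, acting together on functions on trees. -/
noncomputable def cox : Module.End ℤ TreeFun where
  toFun f t := (coxeterMatrix (Tam t.numNodes)).mulVec (fun s => f s.1) ⟨t, rfl⟩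
  map_add' f g := by
    ext t
    exact congrFun (Matrix.mulVec_add _ (fun s : Tam t.numNodes => f s.1) fun s => g s.1) _
  map_smul' c f := by
    ext t
    exact congrFun (Matrix.mulVec_smul _ c fun s : Tam t.numNodes => f s.1) _

theorem cox_apply {n : ℕ} (f : TreeFun) (t : Tam n) :
    cox f t.1 = (coxeterMatrix (Tam n)).mulVec (fun s => f s.1) t := by
  obtain ⟨t, rfl⟩ := t
  rfl

theorem cox_pow_apply {n : ℕ} (k : ℕ) (f : TreeFun) (t : Tam n) :
    (cox ^ k) f t.1 = (coxeterMatrix (Tam n) ^ k).mulVec (fun s => f s.1) t := by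
  induction k generalizing t with
  | zero => simp
  | succ k ih =>
    rw [pow_succ', Module.End.mul_apply, cox_apply, pow_succ', ← Matrix.mulVec_mulVec]
    simp only [ih]

theorem cox_mem {n : ℕ} {f : TreeFun} (hf : f ∈ homog n) : cox f ∈ homog n := by
  intro t ht
  have e : (fun s : Tam t.numNodes => f s.1) = 0 := by
    ext s
    exact hf _ (by rw [s.2]; exact ht)
  rw [cox_apply f (⟨t, rfl⟩ : Tam t.numNodes), e, Matrix.mulVec_zero]
  rfl

theorem cox_upInd (s : BinaryTree Unit) : cox (upInd s) = -downInd s := by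
  ext t
  by_cases ht : t.numNodes = s.numNodes
  · have hI := isUnit_det_incidenceMatrix (Tam s.numNodes)
    have h : coxeterMatrix (Tam s.numNodes) * (incidenceMatrix (Tam s.numNodes)).transpose =
        -incidenceMatrix (Tam s.numNodes) := by
      rw [coxeterMatrix, neg_mul, Matrix.mul_assoc, ← Matrix.transpose_mul,
        Matrix.mul_nonsing_inv _ hI, Matrix.transpose_one, Matrix.mul_one]
    have h' := congrFun (congrFun h ⟨t, ht⟩) ⟨s, rfl⟩
    exact (cox_apply (upInd s) ⟨t, ht⟩).trans h'
  · rw [cox_mem (upInd_mem s) t ht, Pi.neg_apply, downInd_mem s t ht, neg_zero]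

theorem cox_one : cox one = -one := by
  rw [← upInd_nil, cox_upInd, downInd_nil, upInd_nil]

/-- The Coxeter transformation exchanges the two recursions, for principal up-sets and for principal
down-sets. -/
theorem cox_vee_one_conv {p q : ℕ} {f g : TreeFun} (hf : f ∈ homog p) (hg : g ∈ homog q) :
    cox (f ⋎ one ⋆ g) = -(cox f ⋆ (one ⋎ cox g)) := by
  refine homog_induction (P := fun f => cox (f ⋎ one ⋆ g) = -(cox f ⋆ (one ⋎ cox g)))
    ?_ ?_ (fun l _ => ?_) hf
  · intro f f' h h'
    simp only [map_add, LinearMap.add_apply, h, h', neg_add]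
  · intro c f h
    simp only [map_smul, LinearMap.smul_apply, h, smul_neg]
  refine homog_induction (P := fun g => cox (upInd l ⋎ one ⋆ g) =
    -(cox (upInd l) ⋆ (one ⋎ cox g))) ?_ ?_ (fun r _ => ?_) hg
  · intro f f' h h'
    simp only [map_add, h, h', neg_add]
  · intro c f h
    simp only [map_smul, h, smul_neg]
  simp only [← upInd_node, cox_upInd, downInd_node, map_neg, LinearMap.neg_apply, neg_neg]

/-- The identity `cox_conv` when the middle factor is a principal up-set. The induction on the tree
combines the recursion `cox_vee_one_conv` with `vee_conv_vee`, which is used once to expand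
`a ⋎ cox (upInd y)` and once to reassemble `upInd y ⋎ cox c`. -/
theorem cox_conv_upInd {i k : ℕ} (y : BinaryTree Unit) {a c : TreeFun} (ha : a ∈ homog i)
    (hc : c ∈ homog k) : cox (a ⋎ cox (upInd y) ⋆ c) =
      (-1 : ℤ) ^ y.numNodes • (cox a ⋆ (upInd y ⋎ cox c)) := by
  induction y generalizing i k a c with
  | nil =>
    have := cox_vee_one_conv ha hc
    simp only [upInd_nil, cox_one, map_neg, LinearMap.neg_apply, this, BinaryTree.numNodes,
      pow_zero, one_smul, neg_neg]
  | node x l r ihl ihr =>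
    have hl := cox_mem (upInd_mem l)
    have hr := cox_mem (upInd_mem r)
    have e0 : upInd (.node x l r) = upInd l ⋎ one ⋆ upInd r := upInd_node l r
    have e1 : cox (upInd (.node x l r)) = -(cox (upInd l) ⋆ (one ⋎ cox (upInd r))) := by
      rw [e0, cox_vee_one_conv (upInd_mem l) (upInd_mem r)]
    have e2 := vee_conv_vee a (cox (upInd l)) one (cox (upInd r))
    have e3 : a ⋎ cox (upInd (.node x l r)) =
        (a ⋎ cox (upInd l)) ⋎ cox (upInd r) - a ⋎ cox (upInd l) ⋆ (one ⋎ cox (upInd r)) := by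
      simp only [conv_one] at e2
      simp only [e1, e2, map_neg]
      abel
    have e4 := ihr (vee_mem ha hl) hc
    have e5 := ihl ha one_mem
    have e6 := ihl ha (conv_mem (vee_mem one_mem hr) hc)
    have e7 := ihr one_mem hc
    have e8 := vee_conv_vee (upInd l) one (upInd r) (cox c)
    simp only [conv_one, one_conv, cox_one, map_neg, LinearMap.neg_apply] at e4 e5 e6 e7 e8
    simp only [e3, map_sub, LinearMap.sub_apply, conv_assoc, e4, e5, e6, e7, map_neg, map_smul,
      LinearMap.neg_apply, LinearMap.smul_apply, e8, BinaryTree.numNodes]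
    simp only [e0, map_add]
    module

/-- The key identity. For a general middle factor it says that, up to sign, the Coxeter
transformation rotates the three arguments of the operation `(a, b, c) ↦ (a ⋎ cox b) ⋆ c`. -/
theorem cox_conv {i j k : ℕ} {a b c : TreeFun} (ha : a ∈ homog i) (hb : b ∈ homog j)
    (hc : c ∈ homog k) :
    cox (a ⋎ cox b ⋆ c) = (-1 : ℤ) ^ j • (cox a ⋆ (b ⋎ cox c)) := by
  refine homog_induction (P := fun b => cox (a ⋎ cox b ⋆ c) =
    (-1 : ℤ) ^ j • (cox a ⋆ (b ⋎ cox c))) ?_ ?_ (fun y hy => ?_) hb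
  · intro f f' h h'
    simp only [map_add, LinearMap.add_apply, h, h', smul_add]
  · intro d f h
    simp only [map_smul, LinearMap.smul_apply, h, smul_comm d]
  · subst hy
    exact cox_conv_upInd y ha hc

/-! ### Periodicity -/

/-- After `2 |x| + 1` steps the rotation has passed through the whole of `x`: up to sign, the pair of
`x` and `s`, glued at their roots and rooted at the first leaf of `x`, has become rooted at the first
leaf of `s`. -/
theorem cox_pow_conv_upInd (x : BinaryTree Unit) {q : ℕ} {s : TreeFun} (hs : s ∈ homog q) :
    (cox ^ (2 * x.numNodes + 1)) (cox (upInd x) ⋆ s) =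
      (-1 : ℤ) ^ (x.numNodes * q + 1) • (cox s ⋆ upInd x) := by
  induction x generalizing q s with
  | nil => simp [upInd_nil, cox_one, one_conv, conv_one, BinaryTree.numNodes]
  | node x l r ihl ihr =>
    have hl := upInd_mem l
    have hr := upInd_mem r
    have e0 : upInd (.node x l r) = upInd l ⋎ one ⋆ upInd r := upInd_node l r
    have e1 : cox (upInd (.node x l r)) = -(cox (upInd l) ⋆ (one ⋎ cox (upInd r))) := by
      rw [e0, cox_vee_one_conv hl hr]
    have e2 := ihl (conv_mem (vee_mem one_mem (cox_mem hr)) hs)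
    have e3 := cox_conv one_mem hr hs
    have e4 := cox_conv hr hs hl
    have e5 := ihr (vee_mem hs (cox_mem hl))
    have e6 := cox_conv hs hl one_mem
    have e (v : TreeFun) : (cox ^ (2 * (l.numNodes + r.numNodes + 1) + 1)) v =
        (cox ^ (2 * r.numNodes + 1)) (cox ((cox ^ (2 * l.numNodes + 1)) v)) := by
      rw [← Module.End.mul_apply, ← Module.End.mul_apply, ← pow_succ, ← pow_add]
      congr 2
      ring
    simp only [conv_one, cox_one, one_conv, map_neg, LinearMap.neg_apply] at e3 e6
    simp only [BinaryTree.numNodes, e, e1, conv_assoc, map_neg,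
      LinearMap.neg_apply, e2, map_smul, e3, LinearMap.smul_apply, e4, e5, e6]
    simp only [e0, smul_smul, smul_neg, ← neg_smul]
    congr 1
    have parity : l.numNodes * (0 + r.numNodes + 1 + q) + 1 + (r.numNodes + (q +
        (r.numNodes * (q + l.numNodes + 1) + 1 + l.numNodes))) =
        (l.numNodes + r.numNodes + 1) * q +
          2 * (l.numNodes * r.numNodes + l.numNodes + r.numNodes + 1) := by ring
    simp only [mul_neg, neg_neg, ← pow_add, parity]
    rw [pow_add, pow_mul _ 2, neg_one_sq, one_pow, mul_one, pow_succ, mul_neg_one]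

/-- The Coxeter transformation of trees with `n` inner vertices is periodic of period `2 n + 2`. -/
theorem cox_pow_eq {n : ℕ} {f : TreeFun} (hf : f ∈ homog n) : (cox ^ (2 * n + 2)) f = f := by
  refine homog_induction (P := fun f => (cox ^ (2 * n + 2)) f = f) ?_ ?_ (fun x hx => ?_) hf
  · intro f g h h'
    rw [map_add, h, h']
  · intro c f h
    rw [map_smul, h]
  · subst hx
    have h := cox_pow_conv_upInd x one_mem
    rw [conv_one, cox_one, map_neg, LinearMap.neg_apply, one_conv, mul_zero, zero_add, pow_one,
      neg_smul, one_smul, neg_neg] at h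
    rw [pow_succ, Module.End.mul_apply, h]

/-! ### Signs -/

/-- The exceptional functions of degree `n`: the smallest family that contains the unit and is
closed under change of sign and under the ternary operation `(a, b, c) ↦ (a ⋎ cox b) ⋆ c`. -/
inductive Exceptional : ℕ → TreeFun → Prop
  | one : Exceptional 0 one
  | neg {n : ℕ} {f : TreeFun} : Exceptional n f → Exceptional n (-f)
  | ternary {i j k : ℕ} {a b c : TreeFun} : Exceptional i a → Exceptional j b → Exceptional k c →
      Exceptional (i + j + 1 + k) (a ⋎ cox b ⋆ c)

theorem Exceptional.mem {n : ℕ} {f : TreeFun} (h : Exceptional n f) : f ∈ homog n := by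
  induction h with
  | one => exact one_mem
  | neg _ ih => exact neg_mem ih
  | ternary _ _ _ iha ihb ihc => exact conv_mem (vee_mem iha (cox_mem ihb)) ihc

theorem Exceptional.sign_smul {n : ℕ} {f : TreeFun} (h : Exceptional n f) (j : ℕ) :
    Exceptional n ((-1 : ℤ) ^ j • f) := by
  rcases neg_one_pow_eq_or ℤ j with e | e
  · rwa [e, one_smul]
  · rw [e, neg_smul, one_smul]
    exact h.neg

/-- The rotation of the arguments, read on planar ternary trees: `cox f ⋆ s` is the tree of `f`
rerooted at its first leaf, with the tree of `s` grafted at the former root. -/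
theorem Exceptional.cox_conv {p q : ℕ} {f s : TreeFun} (hf : Exceptional p f)
    (hs : Exceptional q s) : Exceptional (p + q) (cox f ⋆ s) := by
  induction hf generalizing q s with
  | one =>
    rw [cox_one, map_neg, LinearMap.neg_apply, one_conv, zero_add]
    exact hs.neg
  | neg _ ih =>
    rw [map_neg, map_neg, LinearMap.neg_apply]
    exact (ih hs).neg
  | @ternary i j k a b c ha hb hc iha _ _ =>
    rw [TamariCoxeter.cox_conv ha.mem hb.mem hc.mem, map_smul, LinearMap.smul_apply, conv_assoc]
    have h := (iha (hb.ternary hc hs)).sign_smul j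
    rwa [show i + (j + k + 1 + q) = i + j + 1 + k + q by ring] at h

theorem Exceptional.cox {n : ℕ} {f : TreeFun} (hf : Exceptional n f) : Exceptional n (cox f) := by
  have h := hf.cox_conv .one
  rwa [conv_one] at h

theorem Exceptional.cox_pow {n : ℕ} {f : TreeFun} (hf : Exceptional n f) (k : ℕ) :
    Exceptional n ((TamariCoxeter.cox ^ k) f) := by
  induction k with
  | zero => exact hf
  | succ k ih =>
    rw [pow_succ', Module.End.mul_apply]
    exact ih.cox

theorem delta_node (l r : BinaryTree Unit) : delta (.node () l r) = delta l ⋎ delta r := by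
  ext t
  cases t with
  | nil => simp [delta, vee_apply_nil]
  | node _ u v =>
    rw [vee_apply_node]
    simp [delta, ite_and]
    split_ifs <;> rfl

theorem exceptional_delta (t : BinaryTree Unit) : Exceptional t.numNodes (delta t) := by
  induction t with
  | nil => exact .one
  | node x l r ihl ihr =>
    -- `cox` is invertible on exceptional functions by periodicity.
    have h := ihl.ternary (ihr.cox_pow (2 * r.numNodes + 1)) .one
    rw [← Module.End.mul_apply cox, ← pow_succ', cox_pow_eq ihr.mem, conv_one, ← delta_node] at h
    exact h

/-- All values of `f` are `0` or `1`, or all of them are `0` or `-1`. -/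
def IsSignedIndicator (f : TreeFun) : Prop :=
  ∃ e : ℤ, (e = 1 ∨ e = -1) ∧ ∀ t, f t = 0 ∨ f t = e

theorem IsSignedIndicator.neg {f : TreeFun} (hf : IsSignedIndicator f) :
    IsSignedIndicator (-f) := by
  obtain ⟨e, he, h⟩ := hf
  refine ⟨-e, by omega, fun t => ?_⟩
  have := h t
  simp only [Pi.neg_apply]
  omega

theorem isSignedIndicator_one : IsSignedIndicator one :=
  ⟨1, .inl rfl, fun t => by simp only [one, delta]; split_ifs <;> simp⟩

theorem sign_mul {e e' : ℤ} (he : e = 1 ∨ e = -1) (he' : e' = 1 ∨ e' = -1) :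
    e * e' = 1 ∨ e * e' = -1 := by
  rcases he with rfl | rfl <;> rcases he' with rfl | rfl <;> simp

theorem eq_zero_or_mul_eq {a b e e' : ℤ} (ha : a = 0 ∨ a = e) (hb : b = 0 ∨ b = e') :
    a * b = 0 ∨ a * b = e * e' := by
  rcases ha with rfl | rfl <;> rcases hb with rfl | rfl <;> simp

theorem IsSignedIndicator.vee {f g : TreeFun} (hf : IsSignedIndicator f)
    (hg : IsSignedIndicator g) : IsSignedIndicator (f ⋎ g) := by
  obtain ⟨e, he, h⟩ := hf
  obtain ⟨e', he', h'⟩ := hg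
  refine ⟨e * e', sign_mul he he', fun t => ?_⟩
  cases t with
  | nil => exact .inl rfl
  | node _ l r => exact eq_zero_or_mul_eq (h l) (h' r)

/-- A homogeneous first factor singles out one cut of each tree, so that no sum occurs in the
product. -/
theorem IsSignedIndicator.conv {p : ℕ} {f g : TreeFun} (hp : f ∈ homog p)
    (hf : IsSignedIndicator f) (hg : IsSignedIndicator g) : IsSignedIndicator (f ⋆ g) := by
  obtain ⟨e, he, h⟩ := hf
  obtain ⟨e', he', h'⟩ := hg
  refine ⟨e * e', sign_mul he he', fun t => ?_⟩
  rw [conv_apply_of_mem hp]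
  split_ifs
  · exact eq_zero_or_mul_eq (h _) (h' _)
  · exact .inl rfl

theorem Exceptional.isSignedIndicator {n : ℕ} {f : TreeFun} (hf : Exceptional n f) :
    IsSignedIndicator f := by
  -- The factor `cox b` of a ternary product is exceptional but not built earlier than the product,
  -- so an induction on the degree is needed around the structural one.
  induction n using Nat.strong_induction_on generalizing f with
  | _ n IH =>
    induction hf with
    | one => exact isSignedIndicator_one
    | neg _ ih => exact (ih IH).neg
    | ternary ha hb hc iha _ ihc =>
      refine .conv (vee_mem ha.mem (cox_mem hb.mem)) (.vee ?_ ?_) ?_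
      · exact IH _ (by omega) ha
      · exact IH _ (by omega) hb.cox
      · exact IH _ (by omega) hc

end TamariCoxeter

open TamariCoxeter in
theorem mainTheorem6 (n : ℕ) :
    coxeterMatrix (Tam n) ^ (2 * n + 2) = 1 ∧
    (∀ S T : Tam n, coxeterMatrix (Tam n) S T = 0 ∨ coxeterMatrix (Tam n) S T = 1 ∨
      coxeterMatrix (Tam n) S T = -1) ∧
    (∀ T S S' : Tam n, coxeterMatrix (Tam n) S T ≠ 0 → coxeterMatrix (Tam n) S' T ≠ 0 →
      SignType.sign (coxeterMatrix (Tam n) S T) =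
        SignType.sign (coxeterMatrix (Tam n) S' T)) := by
  have hδ (T : Tam n) : (fun S : Tam n => delta T.1 S.1) = Pi.single T 1 := by
    ext S
    rw [Pi.single_apply, delta]
    exact if_congr Subtype.ext_iff.symm rfl rfl
  have hpow (k : ℕ) (S T : Tam n) :
      (coxeterMatrix (Tam n) ^ k) S T = (cox ^ k) (delta T.1) S.1 := by
    rw [cox_pow_apply, hδ, Matrix.mulVec_single_one]
    rfl
  have hcol (T : Tam n) : ∃ e : ℤ, (e = 1 ∨ e = -1) ∧
      ∀ S, coxeterMatrix (Tam n) S T = 0 ∨ coxeterMatrix (Tam n) S T = e := by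
    obtain ⟨e, he, h⟩ := (exceptional_delta T.1).cox.isSignedIndicator
    refine ⟨e, he, fun S => ?_⟩
    have h1 := hpow 1 S T
    rw [pow_one, pow_one] at h1
    rw [h1]
    exact h S.1
  refine ⟨?_, fun S T => ?_, fun T S S' hS hS' => ?_⟩
  · ext S T
    have hT : delta T.1 ∈ homog n := by
      have h := delta_mem T.1
      rwa [T.2] at h
    rw [hpow, cox_pow_eq hT, Matrix.one_apply, delta]
    exact if_congr Subtype.ext_iff.symm rfl rfl
  · obtain ⟨e, he, h⟩ := hcol T
    have := h S
    omega
  · obtain ⟨e, he, h⟩ := hcol T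
    rw [(h S).resolve_left hS, (h S').resolve_left hS']
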